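/- **Setting.** Let $\mathcal M_h=\mathcal T_h\cup\mathcal F_h\cup\mathcal E_h\cup\mathcal V_h$ be a finite polyhedral mesh of a domain $U\subset\mathbb R^3$ (elements $T$, planar polygonal faces $F$ with chosen unit normals $n_F$, edges $E$ with chosen unit tangents $t_E$, vertices $V$); faces and elements are simply connected with connected boundary and star-shaped with respect to a ball centred at $x_F$, resp. $x_T$. Let $h_{\mathsf P}$ be the diameter of $\mathsf P$, let $\omega_{TF}=\pm1$ be such that $\omega_{TF}n_F$ is outward for $T$, let $n_{FE}$ be the unit vector with $(t_E,n_{FE},n_F)$ right-handed, let $\omega_{FE}=\pm1$ be such that $\omega_{FE}n_{FE}$ is outward for $F$, and $\omega_{EV}=+1$ if $t_E$ points towards $V$, $-1$ otherwise. For each face (element) $\mathsf P$ select $\eta_{\mathsf P}\ge2$ of its edges (faces), spanning distinct lines (planes) and such that $\mathsf P$ lies on one side of each of these. Fix $k\ge0$ and set $\ell_{\mathsf P}=k+1-\eta_{\mathsf P}$. $\mathcal P^\ell(\mathsf P)$ is the space of polynomials of degree $\le\ell$ on $\mathsf P$ ($\{0\}$ if $\ell<0$); $\boldsymbol{\mathcal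 P}^\ell(\mathsf P)$ is its vector version (tangential on faces). Set $\mathcal R^\ell(F)=\mathrm{rot}_F\mathcal P^{\ell+1}(F)$, $\mathcal R^{c,\ell}(\mathsf P)=(x-x_{\mathsf P})\mathcal P^{\ell-1}(\mathsf P)$, $\mathcal R^\ell(T)=\mathrm{curl}\,\boldsymbol{\mathcal P}^{\ell+1}(T)$, $\mathcal G^\ell(T)=\mathrm{grad}\,\mathcal P^{\ell+1}(T)$, $\mathcal G^{c,\ell}(T)=(x-x_T)\times\boldsymbol{\mathcal P}^{\ell-1}(T)$, where $\mathrm{rot}_Fr=\mathrm{grad}_Fr\times n_F$. $L^2$-orthogonal projectors are denoted by $\pi$. **Spaces.** The elements of $X_{\mathrm{grad}}$ are the families $q=((q_T),(q_F),(q_E),(q_V))$ with $q_T\in\mathcal P^{\ell_T}(T)$, $q_F\in\mathcal P^{\ell_F}(F)$, $q_E\in\mathcal P^{k-1}(E)$, $q_V\in\mathbb R$; those of $X_{\mathrm{curl}}$ are $v=((v_T,v_T^c),(v_F,v_F^c),(v_E))$ with $v_{\mathsf P}\in\mathcal R^{k-1}(\mathsf P)$, $v^c_{\mathsf P}\in\mathcal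 R^{c,\ell_{\mathsf P}+1}(\mathsf P)$, $v_E\in\mathcal P^k(E)$; those of $X_{\mathrm{div}}$ are $w=((w_T,w_T^c),(w_F))$ with $w_T\in\mathcal G^{k-1}(T)$, $w_T^c\in\mathcal G^{c,k}(T)$, $w_F\in\mathcal P^k(F)$. A space with an argument $\mathsf P$ keeps only the components on $\mathsf P$ and on its boundary. **Local operators.** Let $S_{\mathrm{grad},\mathsf P}:X_{\mathrm{grad}}(\mathsf P)\to\boldsymbol{\mathcal P}^k(\mathsf P)$ and $S_{\mathrm{curl},\mathsf P}:X_{\mathrm{curl}}(\mathsf P)\to\boldsymbol{\mathcal P}^k(\mathsf P)$ (for $\mathsf P\in\mathcal T_h\cup\mathcal F_h$) be any linear maps (in particular, the usual serendipity operators). The following are defined by the stated relations, each of which has a unique solution: - $G_Eq\in\mathcal P^k(E)$: $\int_EG_Eq\,r=-\int_Eq_Er'+\sum_{V}\omega_{EV}q_Vr(x_V)$ for $r\in\mathcal P^k(E)$; $\gamma_Eq\in\mathcal P^{k+1}(E)$: $\gamma_Eq(x_V)=q_V$, $\pi^{k-1}_E\gamma_Eq=q_E$. - $G_Fq\in\boldsymbol{\mathcal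 P}^k(F)$: $\int_FG_Fq\cdot(w+\tau)=\sum_E\omega_{FE}\int_E\gamma_Eq\,(w\cdot n_{FE})+\int_FS_{\mathrm{grad},F}q\cdot\tau$ for $(w,\tau)\in\mathcal R^k(F)\times\mathcal R^{c,k}(F)$; $\gamma_Fq\in\mathcal P^{k+1}(F)$: $\int_F\gamma_Fq\,\mathrm{div}_Fw=-\int_FG_Fq\cdot w+\sum_E\omega_{FE}\int_E\gamma_Eq\,(w\cdot n_{FE})$ for $w\in\mathcal R^{c,k+2}(F)$. - $G_Tq\in\boldsymbol{\mathcal P}^k(T)$ and $P_{\mathrm{grad}}q|_T\in\mathcal P^{k+1}(T)$: the same two relations with $T,F,\omega_{TF},n_F,\gamma_F$ in place of $F,E,\omega_{FE},n_{FE},\gamma_E$. - $C_Fv\in\mathcal P^k(F)$: $\int_FC_Fv\,r=\int_Fv_F\cdot\mathrm{rot}_Fr-\sum_E\omega_{FE}\int_Ev_Er$ for $r\in\mathcal P^k(F)$; $\gamma_{t,F}v\in\boldsymbol{\mathcal P}^k(F)$: $\int_F\gamma_{t,F}v\cdot(\mathrm{rot}_Fr+\tau)=\int_FC_Fv\,r+\sum_E\omega_{FE}\int_Ev_Er+\int_FS_{\mathrm{curl},F}v\cdot\tau$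 for $r\in\mathcal P^{k+1}(F)$ of zero integral and $\tau\in\mathcal R^{c,k}(F)$. - $C_Tv\in\boldsymbol{\mathcal P}^k(T)$: $\int_TC_Tv\cdot w=\int_Tv_T\cdot\mathrm{curl}\,w+\sum_F\omega_{TF}\int_F\gamma_{t,F}v\cdot(w\times n_F)$ for $w\in\boldsymbol{\mathcal P}^k(T)$; $P_{\mathrm{curl}}v|_T\in\boldsymbol{\mathcal P}^k(T)$: $\int_TP_{\mathrm{curl}}v\cdot(\mathrm{curl}\,w+\tau)=\int_TC_Tv\cdot w-\sum_F\omega_{TF}\int_F\gamma_{t,F}v\cdot(w\times n_F)+\int_TS_{\mathrm{curl},T}v\cdot\tau$ for $(w,\tau)\in\mathcal G^{c,k+1}(T)\times\mathcal R^{c,k}(T)$. - $D_Tw\in\mathcal P^k(T)$: $\int_TD_Tw\,q=-\int_Tw_T\cdot\mathrm{grad}\,q+\sum_F\omega_{TF}\int_Fw_Fq$ for $q\in\mathcal P^k(T)$; $P_{\mathrm{div}}w|_T\in\boldsymbol{\mathcal P}^k(T)$: $\int_TP_{\mathrm{div}}w\cdot(\mathrm{grad}\,r+\tau)=-\int_TD_Tw\,r+\sum_F\omega_{TF}\int_Fw_Fr+\int_Tw_T^c\cdot\tau$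 for $r\in\mathcal P^{k+1}(T)$ of zero integral and $\tau\in\mathcal G^{c,k}(T)$. **Global operators.** $G_hq\in X_{\mathrm{curl}}$ has components $\pi_{\mathcal R^{k-1}(\mathsf P)}G_{\mathsf P}q$ and $\pi_{\mathcal R^{c,\ell_{\mathsf P}+1}(\mathsf P)}G_{\mathsf P}q$ ($\mathsf P=T,F$) and $G_Eq$; $C_hv\in X_{\mathrm{div}}$ has components $\pi_{\mathcal G^{k-1}(T)}C_Tv$, $\pi_{\mathcal G^{c,k}(T)}C_Tv$ and $C_Fv$; $\mathbf C_hv$ is the piecewise polynomial field equal to $C_Tv$ on $T$. The discrete products are $$(v,w)_{\mathrm{curl}}=\sum_T\Big[\int_TP_{\mathrm{curl}}v\cdot P_{\mathrm{curl}}w+\sum_{F\subset\partial T}h_F\int_F\big((P_{\mathrm{curl}}v)_{t,F}-\gamma_{t,F}v\big)\cdot\big((P_{\mathrm{curl}}w)_{t,F}-\gamma_{t,F}w\big)+\sum_{E\subset\partial T}h_E^2\int_E(P_{\mathrm{curl}}v\cdot t_E-v_E)(P_{\mathrm{curl}}w\cdot t_E-w_E)\Big],$$ $$(v,w)_{\mathrm{div}}=\sum_T\Big[\int_TP_{\mathrm{div}}v\cdot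 P_{\mathrm{div}}w+\sum_{F\subset\partial T}h_F\int_F(P_{\mathrm{div}}v\cdot n_F-v_F)(P_{\mathrm{div}}w\cdot n_F-w_F)\Big].$$ where $(\cdot)_{t,F}$ is the tangential trace and the traces are taken from $T$. **Lie algebra and scheme.** Let $\mathfrak g$ be a finite-dimensional real Lie algebra with an ad-invariant inner product $\langle\cdot,\cdot\rangle$. All spaces are tensorised with $\mathfrak g$, operators act componentwise, and inner products are tensorised with $\langle\cdot,\cdot\rangle$. On (piecewise) fields, $[v\otimes a,q\otimes b]=vq\otimes[a,b]$ and $\star[v\otimes a,w\otimes b]=(v\times w)\otimes[a,b]$. The discrete bracket $\star[v,w]_h\in X_{\mathrm{div}}\otimes\mathfrak g$ has components $\pi_{\mathcal G^{k-1}(T)}\star[P_{\mathrm{curl}}v,P_{\mathrm{curl}}w]$, $\pi_{\mathcal G^{c,k}(T)}\star[P_{\mathrm{curl}}v,P_{\mathrm{curl}}w]$ and $\pi_{\mathcal P^k(F)}(\star[\gamma_{t,F}v,\gamma_{t,F}w]\cdot n_F)$. Let $0=t^0<\dots<t^N$, $\delta^{n+1}v=(v^{n+1}-v^n)/(t^{n+1}-t^n)$,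 $A^{n+1/2}=\frac12(A^n+A^{n+1})$, and let $\mathfrak N$ be one of $$\mathfrak N_1(A^n,A^{n+1};v)=(C_hA^{n+1},\star[A^{n+1/2},v]_h)_{\mathrm{div}}+\big(\tfrac12\star[A^{n+1},A^{n+1}]_h,\,C_hv+\star[A^{n+1/2},v]_h\big)_{\mathrm{div}},$$ $$\mathfrak N_2(A^n,A^{n+1};v)=\int_U\langle\mathbf C_hA^{n+1},\star[P_{\mathrm{curl}}A^{n+1/2},P_{\mathrm{curl}}v]\rangle+\int_U\big\langle\tfrac12\star[P_{\mathrm{curl}}A^{n+1},P_{\mathrm{curl}}A^{n+1}],\,\mathbf C_hv+\star[P_{\mathrm{curl}}A^{n+1/2},P_{\mathrm{curl}}v]\big\rangle.$$ **Statement.** Let $A^n,E^n\in X_{\mathrm{curl}}\otimes\mathfrak g$ and $\lambda^n\in X_{\mathrm{grad}}\otimes\mathfrak g$ ($0\le n\le N$) satisfy, for all $0\le n<N$, all $v\in X_{\mathrm{curl}}\otimes\mathfrak g$ and all $q\in X_{\mathrm{grad}}\otimes\mathfrak g$, $$\delta^{n+1}A=-E^{n+1},$$ $$(\delta^{n+1}E,v)_{\mathrm{curl}}+(G_h\lambda^{n+1},v)_{\mathrm{curl}}+\int_U\langle[P_{\mathrm{curl}}A^{n+1},P_{\mathrm{grad}}\lambda^{n+1}],P_{\mathrm{curl}}v\rangle=(C_hA^{n+1},C_hv)_{\mathrm{div}}+\mathfrak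 N(A^n,A^{n+1};v),$$ $$(\delta^{n+1}E,G_hq)_{\mathrm{curl}}+\int_U\langle P_{\mathrm{curl}}\delta^{n+1}E,[P_{\mathrm{curl}}A^n,P_{\mathrm{grad}}q]\rangle=0.$$ Then, for every $q\in X_{\mathrm{grad}}\otimes\mathfrak g$, the quantity $$\mathfrak C^n(q)=(E^n,G_hq)_{\mathrm{curl}}+\int_U\langle P_{\mathrm{curl}}E^n,[P_{\mathrm{curl}}A^n,P_{\mathrm{grad}}q]\rangle$$ does not depend on $n\in\{0,\dots,N\}$. -/

import Mathlib

namespace YMDDR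

open MeasureTheory MvPolynomial
open scoped Matrix TensorProduct Topology

/-! ## Polynomials and polynomial vector fields on three-dimensional space -/

/-- The Euclidean space of dimension three. -/
abbrev E3 := EuclideanSpace ℝ (Fin 3)

/-- Real polynomials in three variables. -/
abbrev Pol := MvPolynomial (Fin 3) ℝ

/-- Polynomial vector fields. -/
abbrev VPol := Fin 3 → Pol

/-- Value of a polynomial at a point. -/
noncomputable def val (x : E3) (p : Pol) : ℝ := eval (fun i => x i) p

/-- The constant vector field `a`. -/
noncomputable def cst (a : E3) : VPol := fun i => C (a i)

/-- The vector field `x ↦ x - a`. -/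
noncomputable def rad (a : E3) : VPol := fun i => X i - C (a i)

/-- Gradient. -/
noncomputable def grad : Pol →ₗ[ℝ] VPol := LinearMap.pi fun i => (pderiv i).toLinearMap

/-- Directional derivative in the direction `a`. -/
noncomputable def dirDeriv (a : E3) : Pol →ₗ[ℝ] Pol := ∑ i, a i • (pderiv i).toLinearMap

/-- Divergence. -/
noncomputable def dvg (v : VPol) : Pol := ∑ i, pderiv i (v i)

/-- Curl. -/
noncomputable def curl : VPol →ₗ[ℝ] VPol where
  toFun v := ![pderiv 1 (v 2) - pderiv 2 (v 1), pderiv 2 (v 0) - pderiv 0 (v 2),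
    pderiv 0 (v 1) - pderiv 1 (v 0)]
  map_add' v w := by ext1 i; fin_cases i <;> simp <;> ring
  map_smul' c v := by ext1 i; fin_cases i <;> simp [smul_sub]

/-- The pointwise cross product as a bilinear map over the reals. -/
noncomputable def cross : VPol →ₗ[ℝ] VPol →ₗ[ℝ] VPol :=
  LinearMap.mk₂ ℝ (fun v w => v ⨯₃ w) (by simp) (fun c v w => by
    ext1 i; fin_cases i <;> simp [cross_apply, smul_sub]) (by simp) (fun c v w => by
    ext1 i; fin_cases i <;> simp [cross_apply, smul_sub])

/-- The pointwise dot product as a bilinear map over the reals. -/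
noncomputable def dot : VPol →ₗ[ℝ] VPol →ₗ[ℝ] Pol :=
  LinearMap.mk₂ ℝ (fun v w => v ⬝ᵥ w) (fun _ _ _ => add_dotProduct _ _ _)
    (fun c v w => smul_dotProduct c v w) (fun _ _ _ => dotProduct_add _ _ _)
    (fun c v w => dotProduct_smul c v w)

/-- Multiplication of a vector field by a scalar field. -/
noncomputable def scal : VPol →ₗ[ℝ] Pol →ₗ[ℝ] VPol :=
  LinearMap.mk₂ ℝ (fun v p => p • v) (fun _ _ _ => smul_add _ _ _)
    (fun c v p => smul_comm p c v) (fun v p q => add_smul p q v) (fun c v p => smul_assoc c p v)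

/-- The two-dimensional vector curl, in a plane with unit normal `n`: the rotation by `-π/2`
(in that plane, oriented by `n`) of the gradient. -/
noncomputable def vrot (n : E3) : Pol →ₗ[ℝ] VPol := cross.flip (cst n) ∘ₗ grad

/-- The two-dimensional scalar curl, in a plane with unit normal `n`: the divergence of the
rotation by `-π/2` of the field. -/
noncomputable def srot (n : E3) (v : VPol) : Pol := dvg (v ⨯₃ cst n)

/-- The tangential component `n × (v × n)` relative to the unit normal `n`. -/
noncomputable def tang (n : E3) : VPol →ₗ[ℝ] VPol := cross (cst n) ∘ₗ cross.flip (cst n)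

/-- Polynomials of total degree at most `ℓ`; the zero space if `ℓ < 0`. -/
noncomputable def polyDeg (ℓ : ℤ) : Submodule ℝ Pol :=
  if 0 ≤ ℓ then restrictTotalDegree (Fin 3) ℝ ℓ.toNat else ⊥

/-- The space `𝒫^ℓ(P)` of the restrictions to `P` of polynomials of degree at most `ℓ`. Each
restriction is represented by its unique polynomial extension that is constant in the directions
orthogonal to the affine span of `P` (no condition if `P` is three-dimensional). This extension has
the same degree bound, and its gradient is the gradient of the restriction along `P`. -/
noncomputable def polyOn (P : Set E3) (ℓ : ℤ) : Submodule ℝ Pol :=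
  polyDeg ℓ ⊓ ⨅ a : (vectorSpan ℝ P)ᗮ, LinearMap.ker (dirDeriv a)

/-- The space of vector polynomials on `P` of degree at most `ℓ`, with values in the tangent space
of `P` (no condition on the values if `P` is three-dimensional). -/
noncomputable def vPolyOn (P : Set E3) (ℓ : ℤ) : Submodule ℝ VPol :=
  Submodule.pi Set.univ (fun _ => polyOn P ℓ) ⊓
    ⨅ a : (vectorSpan ℝ P)ᗮ, LinearMap.ker (dot (cst a))

/-! ## Integration on the mesh entities -/

theorem continuous_val (p : Pol) : Continuous fun x : E3 => val x p :=
  (MvPolynomial.continuous_eval p).comp (by fun_prop)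

theorem measure_lt_top {d : ℕ} {K : Set E3} (hK : IsCompact K)
    (hd : Module.finrank ℝ (vectorSpan ℝ K) = d) : μHE[d] K < ⊤ := by
  rcases K.eq_empty_or_nonempty with rfl | ⟨p, hp⟩
  · simp
  · have hpK : p ∈ affineSpan ℝ K := subset_affineSpan ℝ K hp
    let q : affineSpan ℝ K := ⟨p, hpK⟩
    have : Nonempty (affineSpan ℝ K) := ⟨q⟩
    have hval : Subtype.val '' (Subtype.val ⁻¹' K : Set (affineSpan ℝ K)) = K := by
      ext x
      exact ⟨fun ⟨y, hy, hyx⟩ => hyx ▸ hy, fun hx => ⟨⟨x, subset_affineSpan ℝ K hx⟩, hx, rfl⟩⟩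
    have hd' : Module.finrank ℝ (affineSpan ℝ K).direction = d := by
      rw [direction_affineSpan, hd]
    have hc : IsCompact (Subtype.val ⁻¹' K : Set (affineSpan ℝ K)) := by
      rw [Subtype.isCompact_iff, hval]; exact hK
    rw [← hval, AffineSubspace.euclideanHausdorffMeasure_coe_image, ← hd',
      EuclideanGeometry.euclideanHausdorffMeasure_eq q]
    have he := (IsometryEquiv.vaddConst q).toHomeomorph.measurableEmbedding
    have : (volume.map (IsometryEquiv.vaddConst q)) (Subtype.val ⁻¹' K : Set (affineSpan ℝ K)) =
        volume ((IsometryEquiv.vaddConst q) ⁻¹' (Subtype.val ⁻¹' K)) := he.map_apply _ _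
    rw [this]
    have hc2 := (IsometryEquiv.vaddConst q).symm.toHomeomorph.isCompact_image.2 hc
    have himg : (IsometryEquiv.vaddConst q) ⁻¹' (Subtype.val ⁻¹' K) =
        (IsometryEquiv.vaddConst q).symm.toHomeomorph '' (Subtype.val ⁻¹' K) :=
      ((IsometryEquiv.vaddConst q).symm.toEquiv.image_eq_preimage_symm _).symm
    rw [himg]
    exact hc2.measure_lt_top

/-- The integral of polynomials over a compact set `K` of dimension `d`, with respect to the
`d`-dimensional volume (length for `d = 1`, area for `d = 2`, Lebesgue measure for `d = 3`). -/
noncomputable def integ (d : ℕ) (K : Set E3) (hK : IsCompact K)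
    (hd : Module.finrank ℝ (vectorSpan ℝ K) = d) : Pol →ₗ[ℝ] ℝ :=
  have hint : ∀ p : Pol, IntegrableOn (fun x => val x p) K μHE[d] := fun p =>
    (continuous_val p).continuousOn.integrableOn_of_subset_isCompact hK hK.measurableSet
      subset_rfl (measure_lt_top hK hd).ne
  { toFun := fun p => ∫ x in K, val x p ∂μHE[d]
    map_add' := fun p q => by
      rw [← integral_add (hint p) (hint q)]; simp [val]
    map_smul' := fun c p => by
      rw [RingHom.id_apply, smul_eq_mul, ← integral_const_mul]; simp [val, smul_eval] }

/-- The bilinear form `(v, w) ↦ I (v ⋅ w)` on vector fields, for a linear functional `I`. -/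
noncomputable def l2V (I : Pol →ₗ[ℝ] ℝ) : LinearMap.BilinForm ℝ VPol := dot.compr₂ I

/-- The bilinear form `(p, q) ↦ I (p q)` on scalar fields, for a linear functional `I`. -/
noncomputable def l2S (I : Pol →ₗ[ℝ] ℝ) : LinearMap.BilinForm ℝ Pol :=
  (LinearMap.mul ℝ Pol).compr₂ I

open scoped Classical in
/-- The linear map `S` such that `P x (S x)` holds for all `x`. It is used for variational problems
with data `x` that have a unique solution, depending linearly on `x`. (If there is no linear
solution map, the value is `0`.) -/
noncomputable def linSol {X V : Type} [AddCommGroup X] [Module ℝ X] [AddCommGroup V] [Module ℝ V]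
    (P : X → V → Prop) : X →ₗ[ℝ] V :=
  if h : ∃ S : X →ₗ[ℝ] V, ∀ x, P x (S x) then h.choose else 0

theorem linSol_spec {X V : Type} [AddCommGroup X] [Module ℝ X] [AddCommGroup V] [Module ℝ V]
    {P : X → V → Prop} (h : ∃ S : X →ₗ[ℝ] V, ∀ x, P x (S x)) (x : X) : P x (linSol P x) := by
  unfold linSol
  rw [dif_pos h]
  exact h.choose_spec x

/-- The `L²`-orthogonal projector of scalar fields on `W`, the integral being `I`. -/
noncomputable def projS (I : Pol →ₗ[ℝ] ℝ) (W : Submodule ℝ Pol) : Pol →ₗ[ℝ] W :=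
  linSol fun f (y : W) => ∀ w ∈ W, I (y * w) = I (f * w)

/-- The `L²`-orthogonal projector of vector fields on `W`, the integral being `I`. -/
noncomputable def projV (I : Pol →ₗ[ℝ] ℝ) (W : Submodule ℝ VPol) : VPol →ₗ[ℝ] W :=
  linSol fun f (y : W) => ∀ w ∈ W, I (y ⬝ᵥ w) = I (f ⬝ᵥ w)

/-! ## Polyhedral meshes -/

/-- A polyhedral mesh with finitely many elements, faces, edges and vertices. Edges are segments,
oriented from `tail` to `head`; faces are closed polygons, oriented by a unit normal; elements are
closed polyhedra. The elements partition (up to their boundaries) the domain `⋃ t, elem t`. -/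
structure PolyMesh where
  Elem : Type
  Face : Type
  Edge : Type
  Vert : Type
  [fintypeElem : Fintype Elem]
  [fintypeFace : Fintype Face]
  [fintypeEdge : Fintype Edge]
  [fintypeVert : Fintype Vert]
  pos : Vert → E3
  tail : Edge → Vert
  head : Edge → Vert
  face : Face → Set E3
  normal : Face → E3
  elem : Elem → Set E3
  /-- The points with respect to which faces and elements are star-shaped. -/
  centerF : Face → E3
  centerT : Elem → E3
  pos_injective : Function.Injective pos
  tail_ne_head : ∀ e, tail e ≠ head e
  norm_normal : ∀ f, ‖normal f‖ = 1
  vectorSpan_face : ∀ f, vectorSpan ℝ (face f) = (ℝ ∙ normal f)ᗮ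
  isCompact_face : ∀ f, IsCompact (face f)
  closure_face : ∀ f, closure (intrinsicInterior ℝ (face f)) = face f
  /-- The boundary of a face is a union of edges. -/
  boundary_face : ∀ f, ∀ x ∈ intrinsicFrontier ℝ (face f), ∃ e,
    x ∈ segment ℝ (pos (tail e)) (pos (head e)) ∧
      segment ℝ (pos (tail e)) (pos (head e)) ⊆ intrinsicFrontier ℝ (face f)
  nonempty_elem : ∀ t, (elem t).Nonempty
  isCompact_elem : ∀ t, IsCompact (elem t)
  closure_elem : ∀ t, closure (interior (elem t)) = elem t
  /-- The boundary of an element is a union of faces. -/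
  boundary_elem : ∀ t, ∀ x ∈ frontier (elem t), ∃ f, x ∈ face f ∧ face f ⊆ frontier (elem t)
  /-- Faces and elements are topologically trivial. -/
  simplyConnected_face : ∀ f, SimplyConnectedSpace (face f)
  simplyConnected_elem : ∀ t, SimplyConnectedSpace (elem t)
  isConnected_boundary_face : ∀ f, IsConnected (intrinsicFrontier ℝ (face f))
  isConnected_boundary_elem : ∀ t, IsConnected (frontier (elem t))
  /-- The open mesh entities are pairwise disjoint. -/
  disjoint_elem : ∀ t t', t ≠ t' → Disjoint (interior (elem t)) (interior (elem t'))
  disjoint_face : ∀ f f', f ≠ f' →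
    Disjoint (intrinsicInterior ℝ (face f)) (intrinsicInterior ℝ (face f'))
  disjoint_edge : ∀ e e', e ≠ e' → Disjoint (openSegment ℝ (pos (tail e)) (pos (head e)))
    (openSegment ℝ (pos (tail e')) (pos (head e')))
  disjoint_face_edge : ∀ f e,
    Disjoint (intrinsicInterior ℝ (face f)) (segment ℝ (pos (tail e)) (pos (head e)))
  disjoint_edge_vert : ∀ e v, pos v ∉ openSegment ℝ (pos (tail e)) (pos (head e))
  /-- Every face (edge, vertex) belongs to the boundary of an element (face, edge). -/
  exists_elem : ∀ f, ∃ t, face f ⊆ frontier (elem t)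
  exists_face : ∀ e, ∃ f,
    segment ℝ (pos (tail e)) (pos (head e)) ⊆ intrinsicFrontier ℝ (face f)
  exists_edge : ∀ v, ∃ e, v = tail e ∨ v = head e
  /-- Faces and elements are star-shaped with respect to a ball around their centre. -/
  centerF_mem : ∀ f, centerF f ∈ face f
  starConvex_face : ∀ f, ∃ r > 0, ∀ y ∈ Metric.ball (centerF f) r,
    y ∈ affineSpan ℝ (face f) → StarConvex ℝ y (face f)
  centerT_mem : ∀ t, centerT t ∈ elem t
  starConvex_elem : ∀ t, ∃ r > 0, ∀ y ∈ Metric.ball (centerT t) r, StarConvex ℝ y (elem t)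

namespace PolyMesh

attribute [instance] fintypeElem fintypeFace fintypeEdge fintypeVert

variable (M : PolyMesh)

/-- An edge as a set. -/
def seg (e : M.Edge) : Set E3 := segment ℝ (M.pos (M.tail e)) (M.pos (M.head e))

/-- The unit tangent of an edge. -/
noncomputable def tangent (e : M.Edge) : E3 :=
  ‖M.pos (M.head e) - M.pos (M.tail e)‖⁻¹ • (M.pos (M.head e) - M.pos (M.tail e))

open scoped Classical in
/-- The vertices of an edge. -/
noncomputable def vertsE (e : M.Edge) : Finset M.Vert := {M.tail e, M.head e}

open scoped Classical in
/-- The edges of a face. -/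
noncomputable def edgesF (f : M.Face) : Finset M.Edge :=
  Finset.univ.filter fun e => M.seg e ⊆ intrinsicFrontier ℝ (M.face f)

open scoped Classical in
/-- The vertices of a face. -/
noncomputable def vertsF (f : M.Face) : Finset M.Vert := (M.edgesF f).biUnion M.vertsE

open scoped Classical in
/-- The faces of an element. -/
noncomputable def facesT (t : M.Elem) : Finset M.Face :=
  Finset.univ.filter fun f => M.face f ⊆ frontier (M.elem t)

open scoped Classical in
/-- The edges of an element. -/
noncomputable def edgesT (t : M.Elem) : Finset M.Edge := (M.facesT t).biUnion M.edgesF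

open scoped Classical in
/-- The vertices of an element. -/
noncomputable def vertsT (t : M.Elem) : Finset M.Vert := (M.edgesT t).biUnion M.vertsE

theorem mem_vertsF {f : M.Face} {e : M.Edge} (he : e ∈ M.edgesF f) {v : M.Vert}
    (hv : v ∈ M.vertsE e) : v ∈ M.vertsF f := by
  classical exact Finset.mem_biUnion.2 ⟨e, he, hv⟩

theorem mem_edgesT {t : M.Elem} {f : M.Face} (hf : f ∈ M.facesT t) {e : M.Edge}
    (he : e ∈ M.edgesF f) : e ∈ M.edgesT t := by
  classical exact Finset.mem_biUnion.2 ⟨f, hf, he⟩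

theorem mem_vertsT {t : M.Elem} {f : M.Face} (hf : f ∈ M.facesT t) {v : M.Vert}
    (hv : v ∈ M.vertsF f) : v ∈ M.vertsT t := by
  classical
  obtain ⟨e, he, hv⟩ := Finset.mem_biUnion.1 hv
  exact Finset.mem_biUnion.2 ⟨e, M.mem_edgesT hf he, hv⟩

open scoped Classical in
/-- The orientation of a vertex relative to an edge: `1` if the tangent points towards the
vertex. -/
noncomputable def ωEV (e : M.Edge) (v : M.Vert) : ℝ := if v = M.head e then 1 else -1

/-- The unit vector `n_FE` in the plane of `f`, normal to `e`, such that `(t_E, n_FE, n_F)` is a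
right-handed system. -/
noncomputable def normalFE (f : M.Face) (e : M.Edge) : E3 :=
  WithLp.toLp 2 ((M.normal f).ofLp ⨯₃ (M.tangent e).ofLp)

open scoped Classical in
/-- The orientation of an edge relative to a face: `1` if `n_FE` points outside the face, so that
`ω_FE n_FE` is the outer normal, as in the integration by parts formulas on the face. -/
noncomputable def ωFE (f : M.Face) (e : M.Edge) : ℝ :=
  if ∀ x ∈ openSegment ℝ (M.pos (M.tail e)) (M.pos (M.head e)),
    ∀ᶠ s in 𝓝[>] (0 : ℝ), x + s • M.normalFE f e ∉ M.face f then 1 else -1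

open scoped Classical in
/-- The orientation of a face relative to an element: `1` if the normal points outside. -/
noncomputable def ωTF (t : M.Elem) (f : M.Face) : ℝ :=
  if ∀ x ∈ intrinsicInterior ℝ (M.face f),
    ∀ᶠ s in 𝓝[>] (0 : ℝ), x + s • M.normal f ∉ M.elem t then 1 else -1

theorem isCompact_seg (e : M.Edge) : IsCompact (M.seg e) := by
  unfold seg
  rw [segment_eq_image_lineMap]
  exact isCompact_Icc.image (AffineMap.lineMap_continuous)

theorem finrank_seg (e : M.Edge) : Module.finrank ℝ (vectorSpan ℝ (M.seg e)) = 1 := by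
  have h : vectorSpan ℝ (M.seg e) = ℝ ∙ (M.pos (M.head e) - M.pos (M.tail e)) := by
    rw [← direction_affineSpan, seg, ← convexHull_pair, affineSpan_convexHull, direction_affineSpan,
      vectorSpan_pair_rev, vsub_eq_sub]
  rw [h]
  exact finrank_span_singleton (sub_ne_zero.2 fun hh => M.tail_ne_head e (M.pos_injective hh).symm)

theorem finrank_face (f : M.Face) : Module.finrank ℝ (vectorSpan ℝ (M.face f)) = 2 := by
  have hn : M.normal f ≠ 0 := fun h => by simpa [h] using M.norm_normal f
  have := Submodule.finrank_add_finrank_orthogonal (ℝ ∙ M.normal f)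
  rw [M.vectorSpan_face]
  rw [finrank_span_singleton hn, finrank_euclideanSpace_fin] at this
  omega

theorem finrank_elem (t : M.Elem) : Module.finrank ℝ (vectorSpan ℝ (M.elem t)) = 3 := by
  have h : (interior (M.elem t)).Nonempty := by
    rw [← closure_nonempty_iff, M.closure_elem]
    exact M.nonempty_elem t
  have : affineSpan ℝ (M.elem t) = ⊤ :=
    top_unique ((isOpen_interior.affineSpan_eq_top h).symm.le.trans
      (affineSpan_mono ℝ interior_subset))
  rw [← direction_affineSpan, this, AffineSubspace.direction_top, finrank_top,
    finrank_euclideanSpace_fin]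

/-- The integral over an edge. -/
noncomputable def intE (e : M.Edge) : Pol →ₗ[ℝ] ℝ :=
  integ 1 (M.seg e) (M.isCompact_seg e) (M.finrank_seg e)

/-- The integral over a face. -/
noncomputable def intF (f : M.Face) : Pol →ₗ[ℝ] ℝ :=
  integ 2 (M.face f) (M.isCompact_face f) (M.finrank_face f)

/-- The integral over an element. -/
noncomputable def intT (t : M.Elem) : Pol →ₗ[ℝ] ℝ :=
  integ 3 (M.elem t) (M.isCompact_elem t) (M.finrank_elem t)

/-- The field `x ↦ x - x_F` on a face, extended constantly in the normal direction. -/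
noncomputable def radF (f : M.Face) : VPol := tang (M.normal f) (rad (M.centerF f))

/-- `ℛ^ℓ(F) = rot_F 𝒫^{ℓ+1}(F)`. -/
noncomputable def RolyF (f : M.Face) (ℓ : ℤ) : Submodule ℝ VPol :=
  (polyOn (M.face f) (ℓ + 1)).map (vrot (M.normal f))

/-- `ℛ^{c,ℓ}(F) = (x - x_F) 𝒫^{ℓ-1}(F)`. -/
noncomputable def RolycF (f : M.Face) (ℓ : ℤ) : Submodule ℝ VPol :=
  (polyOn (M.face f) (ℓ - 1)).map (scal (M.radF f))

/-- `ℛ^ℓ(T) = curl 𝒫^{ℓ+1}(T)³`. -/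
noncomputable def RolyT (t : M.Elem) (ℓ : ℤ) : Submodule ℝ VPol :=
  (vPolyOn (M.elem t) (ℓ + 1)).map curl

/-- `ℛ^{c,ℓ}(T) = (x - x_T) 𝒫^{ℓ-1}(T)`. -/
noncomputable def RolycT (t : M.Elem) (ℓ : ℤ) : Submodule ℝ VPol :=
  (polyOn (M.elem t) (ℓ - 1)).map (scal (rad (M.centerT t)))

/-- `𝒢^ℓ(T) = grad 𝒫^{ℓ+1}(T)`. -/
noncomputable def GolyT (t : M.Elem) (ℓ : ℤ) : Submodule ℝ VPol :=
  (polyOn (M.elem t) (ℓ + 1)).map grad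

/-- `𝒢^{c,ℓ}(T) = (x - x_T) × 𝒫^{ℓ-1}(T)³`. -/
noncomputable def GolycT (t : M.Elem) (ℓ : ℤ) : Submodule ℝ VPol :=
  (vPolyOn (M.elem t) (ℓ - 1)).map (cross (rad (M.centerT t)))

end PolyMesh

/-- The choice, for each face (element), of a set of at least two of its edges (faces) that are not
pairwise aligned and such that the face (element) lies on one side of each of them. -/
structure BoundarySelection (M : PolyMesh) where
  bdryF : M.Face → Finset M.Edge
  bdryT : M.Elem → Finset M.Face
  bdryF_subset : ∀ f, bdryF f ⊆ M.edgesF f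
  bdryT_subset : ∀ t, bdryT t ⊆ M.facesT t
  two_le_bdryF : ∀ f, 2 ≤ (bdryF f).card
  two_le_bdryT : ∀ t, 2 ≤ (bdryT t).card
  not_aligned_bdryF : ∀ f, ∀ e ∈ bdryF f, ∀ e' ∈ bdryF f, e ≠ e' →
    affineSpan ℝ (M.seg e) ≠ affineSpan ℝ (M.seg e')
  not_aligned_bdryT : ∀ t, ∀ f ∈ bdryT t, ∀ f' ∈ bdryT t, f ≠ f' →
    affineSpan ℝ (M.face f) ≠ affineSpan ℝ (M.face f')
  one_side_bdryF : ∀ f, ∀ e ∈ bdryF f, ∀ y ∈ M.seg e,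
    (∀ x ∈ M.face f, 0 ≤ inner ℝ (x - y) (M.normalFE f e)) ∨
      (∀ x ∈ M.face f, inner ℝ (x - y) (M.normalFE f e) ≤ 0)
  one_side_bdryT : ∀ t, ∀ f ∈ bdryT t, ∀ y ∈ M.face f,
    (∀ x ∈ M.elem t, 0 ≤ inner ℝ (x - y) (M.normal f)) ∨
      (∀ x ∈ M.elem t, inner ℝ (x - y) (M.normal f) ≤ 0)

section SDDR

variable {M : PolyMesh} (B : BoundarySelection M) (k : ℕ)

/-- The degree `ℓ_F = k + 1 - η_F`. -/
def degF (f : M.Face) : ℤ := (k : ℤ) + 1 - (B.bdryF f).card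

/-- The degree `ℓ_T = k + 1 - η_T`. -/
def degT (t : M.Elem) : ℤ := (k : ℤ) + 1 - (B.bdryT t).card

/-! ### The discrete spaces, on a mesh entity (and its boundary) and on the whole mesh -/

/-- Polynomial component of the gradient space on an edge. -/
abbrev GradE (e : M.Edge) : Type := polyOn (M.seg e) ((k : ℤ) - 1)

/-- Polynomial component of the gradient space on a face. -/
abbrev GradF (f : M.Face) : Type := polyOn (M.face f) (degF B k f)

/-- Polynomial component of the gradient space on an element. -/
abbrev GradT (t : M.Elem) : Type := polyOn (M.elem t) (degT B k t)

/-- The gradient space on an edge: `(q_E, (q_V)_V)`. -/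
abbrev XgradE (e : M.Edge) : Type := GradE k e × (M.vertsE e → ℝ)

/-- The gradient space on a face: `(q_F, (q_E)_E, (q_V)_V)`. -/
abbrev XgradF (f : M.Face) : Type :=
  GradF B k f × (∀ e : M.edgesF f, GradE k e.1) × (M.vertsF f → ℝ)

/-- The gradient space on an element: `(q_T, (q_F)_F, (q_E)_E, (q_V)_V)`. -/
abbrev XgradT (t : M.Elem) : Type :=
  GradT B k t × (∀ f : M.facesT t, GradF B k f.1) × (∀ e : M.edgesT t, GradE k e.1) ×
    (M.vertsT t → ℝ)

/-- The gradient space on the mesh: `((q_T)_T, (q_F)_F, (q_E)_E, (q_V)_V)`. -/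
abbrev Xgrad : Type :=
  (∀ t : M.Elem, GradT B k t) × (∀ f : M.Face, GradF B k f) × (∀ e : M.Edge, GradE k e) ×
    (M.Vert → ℝ)

/-- Polynomial component of the curl space on an edge. -/
abbrev CurlE (e : M.Edge) : Type := polyOn (M.seg e) (k : ℤ)

/-- Polynomial components of the curl space on a face. -/
abbrev CurlF (f : M.Face) : Type := M.RolyF f ((k : ℤ) - 1) × M.RolycF f (degF B k f + 1)

/-- Polynomial components of the curl space on an element. -/
abbrev CurlT (t : M.Elem) : Type := M.RolyT t ((k : ℤ) - 1) × M.RolycT t (degT B k t + 1)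

/-- The curl space on a face: `((v_F, v_F^c), (v_E)_E)`. -/
abbrev XcurlF (f : M.Face) : Type := CurlF B k f × (∀ e : M.edgesF f, CurlE k e.1)

/-- The curl space on an element: `((v_T, v_T^c), (v_F, v_F^c)_F, (v_E)_E)`. -/
abbrev XcurlT (t : M.Elem) : Type :=
  CurlT B k t × (∀ f : M.facesT t, CurlF B k f.1) × (∀ e : M.edgesT t, CurlE k e.1)

/-- The curl space on the mesh: `((v_T, v_T^c)_T, (v_F, v_F^c)_F, (v_E)_E)`. -/
abbrev Xcurl : Type :=
  (∀ t : M.Elem, CurlT B k t) × (∀ f : M.Face, CurlF B k f) × (∀ e : M.Edge, CurlE k e)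

/-- Polynomial component of the divergence space on a face. -/
abbrev DivF (f : M.Face) : Type := polyOn (M.face f) (k : ℤ)

/-- Polynomial components of the divergence space on an element. -/
abbrev DivT (t : M.Elem) : Type := M.GolyT t ((k : ℤ) - 1) × M.GolycT t (k : ℤ)

/-- The divergence space on an element: `((w_T, w_T^c), (w_F)_F)`. -/
abbrev XdivT (t : M.Elem) : Type := DivT k t × (∀ f : M.facesT t, DivF k f.1)

variable (M) in
/-- The divergence space on the mesh: `((w_T, w_T^c)_T, (w_F)_F)`. -/
abbrev Xdiv : Type := (∀ t : M.Elem, DivT k t) × (∀ f : M.Face, DivF k f)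

/-- Restriction of the gradient space from a face to one of its edges. -/
def resGradFE (f : M.Face) (e : M.edgesF f) : XgradF B k f →ₗ[ℝ] XgradE k e.1 where
  toFun q := (q.2.1 e, fun v => q.2.2 ⟨v.1, M.mem_vertsF e.2 v.2⟩)
  map_add' _ _ := rfl
  map_smul' _ _ := rfl

/-- Restriction of the gradient space from an element to one of its faces. -/
def resGradTF (t : M.Elem) (f : M.facesT t) : XgradT B k t →ₗ[ℝ] XgradF B k f.1 where
  toFun q := (q.2.1 f, fun e => q.2.2.1 ⟨e.1, M.mem_edgesT f.2 e.2⟩,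
    fun v => q.2.2.2 ⟨v.1, M.mem_vertsT f.2 v.2⟩)
  map_add' _ _ := rfl
  map_smul' _ _ := rfl

/-- Restriction of the gradient space from the mesh to an edge. -/
def resGradE (e : M.Edge) : Xgrad B k →ₗ[ℝ] XgradE k e where
  toFun q := (q.2.2.1 e, fun v => q.2.2.2 v.1)
  map_add' _ _ := rfl
  map_smul' _ _ := rfl

/-- Restriction of the gradient space from the mesh to a face. -/
def resGradF (f : M.Face) : Xgrad B k →ₗ[ℝ] XgradF B k f where
  toFun q := (q.2.1 f, fun e => q.2.2.1 e.1, fun v => q.2.2.2 v.1)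
  map_add' _ _ := rfl
  map_smul' _ _ := rfl

/-- Restriction of the gradient space from the mesh to an element. -/
def resGradT (t : M.Elem) : Xgrad B k →ₗ[ℝ] XgradT B k t where
  toFun q := (q.1 t, fun f => q.2.1 f.1, fun e => q.2.2.1 e.1, fun v => q.2.2.2 v.1)
  map_add' _ _ := rfl
  map_smul' _ _ := rfl

/-- Restriction of the curl space from an element to one of its faces. -/
def resCurlTF (t : M.Elem) (f : M.facesT t) : XcurlT B k t →ₗ[ℝ] XcurlF B k f.1 where
  toFun v := (v.2.1 f, fun e => v.2.2 ⟨e.1, M.mem_edgesT f.2 e.2⟩)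
  map_add' _ _ := rfl
  map_smul' _ _ := rfl

/-- Restriction of the curl space from the mesh to a face. -/
def resCurlF (f : M.Face) : Xcurl B k →ₗ[ℝ] XcurlF B k f where
  toFun v := (v.2.1 f, fun e => v.2.2 e.1)
  map_add' _ _ := rfl
  map_smul' _ _ := rfl

/-- Restriction of the curl space from the mesh to an element. -/
def resCurlT (t : M.Elem) : Xcurl B k →ₗ[ℝ] XcurlT B k t where
  toFun v := (v.1 t, fun f => v.2.1 f.1, fun e => v.2.2 e.1)
  map_add' _ _ := rfl
  map_smul' _ _ := rfl

/-- Restriction of the divergence space from the mesh to an element. -/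
def resDivT (t : M.Elem) : Xdiv M k →ₗ[ℝ] XdivT k t where
  toFun w := (w.1 t, fun f => w.2 f.1)
  map_add' _ _ := rfl
  map_smul' _ _ := rfl

/-- Linear maps `X_grad(F) → 𝒫^k(F)²`. -/
abbrev SGradF (f : M.Face) : Type := XgradF B k f →ₗ[ℝ] vPolyOn (M.face f) (k : ℤ)

/-- Linear maps `X_curl(F) → 𝒫^k(F)²`. -/
abbrev SCurlF (f : M.Face) : Type := XcurlF B k f →ₗ[ℝ] vPolyOn (M.face f) (k : ℤ)

/-- Linear maps `X_grad(T) → 𝒫^k(T)³`. -/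
abbrev SGradT (t : M.Elem) : Type := XgradT B k t →ₗ[ℝ] vPolyOn (M.elem t) (k : ℤ)

/-- Linear maps `X_curl(T) → 𝒫^k(T)³`. -/
abbrev SCurlT (t : M.Elem) : Type := XcurlT B k t →ₗ[ℝ] vPolyOn (M.elem t) (k : ℤ)

/-- A choice of the serendipity gradients and curls on all faces and elements. Any linear maps
between the local spaces are allowed, so that every particular construction is covered; the usual
polynomially consistent one is `usualSerendipity` below. -/
structure SerendipityOps where
  gradF : ∀ f : M.Face, SGradF B k f
  curlF : ∀ f : M.Face, SCurlF B k f
  gradT : ∀ t : M.Elem, SGradT B k t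
  curlT : ∀ t : M.Elem, SCurlT B k t

variable {B k}

/-! ### Operators on the gradient space -/

/-- The edge gradient. -/
noncomputable def edgeGrad (e : M.Edge) : XgradE k e →ₗ[ℝ] polyOn (M.seg e) (k : ℤ) :=
  linSol fun q (G : polyOn (M.seg e) (k : ℤ)) => ∀ r ∈ polyOn (M.seg e) (k : ℤ),
    M.intE e (G * r) = -M.intE e (q.1 * dirDeriv (M.tangent e) r) +
      ∑ v, M.ωEV e v.1 * q.2 v * val (M.pos v.1) r

/-- The edge potential. -/
noncomputable def edgePot (e : M.Edge) : XgradE k e →ₗ[ℝ] polyOn (M.seg e) ((k : ℤ) + 1) :=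
  linSol fun q (γ : polyOn (M.seg e) ((k : ℤ) + 1)) =>
    (∀ v, val (M.pos v.1) γ = q.2 v) ∧
      projS (M.intE e) (polyOn (M.seg e) ((k : ℤ) - 1)) γ = q.1

/-- The face gradient. -/
noncomputable def faceGrad {f : M.Face} (s : SGradF B k f) :
    XgradF B k f →ₗ[ℝ] vPolyOn (M.face f) (k : ℤ) :=
  linSol fun q (G : vPolyOn (M.face f) (k : ℤ)) => ∀ w ∈ M.RolyF f k, ∀ τ ∈ M.RolycF f k,
    M.intF f (G ⬝ᵥ (w + τ)) =
      ∑ e, M.ωFE f e.1 *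
        M.intE e.1 (edgePot e.1 (resGradFE B k f e q) * (w ⬝ᵥ cst (M.normalFE f e.1))) +
      M.intF f (s q ⬝ᵥ τ)

/-- The face scalar potential. -/
noncomputable def facePot {f : M.Face} (s : SGradF B k f) :
    XgradF B k f →ₗ[ℝ] polyOn (M.face f) ((k : ℤ) + 1) :=
  linSol fun q (γ : polyOn (M.face f) ((k : ℤ) + 1)) => ∀ w ∈ M.RolycF f ((k : ℤ) + 2),
    M.intF f (γ * dvg w) = -M.intF f (faceGrad s q ⬝ᵥ w) +
      ∑ e, M.ωFE f e.1 *
        M.intE e.1 (edgePot e.1 (resGradFE B k f e q) * (w ⬝ᵥ cst (M.normalFE f e.1)))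

/-- The element gradient. -/
noncomputable def elemGrad (sF : ∀ f, SGradF B k f) {t : M.Elem} (s : SGradT B k t) :
    XgradT B k t →ₗ[ℝ] vPolyOn (M.elem t) (k : ℤ) :=
  linSol fun q (G : vPolyOn (M.elem t) (k : ℤ)) => ∀ w ∈ M.RolyT t k, ∀ τ ∈ M.RolycT t k,
    M.intT t (G ⬝ᵥ (w + τ)) =
      ∑ f, M.ωTF t f.1 *
        M.intF f.1 (facePot (sF f.1) (resGradTF B k t f q) * (w ⬝ᵥ cst (M.normal f.1))) +
      M.intT t (s q ⬝ᵥ τ)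

/-- The element scalar potential `P_grad`. -/
noncomputable def elemPot (sF : ∀ f, SGradF B k f) {t : M.Elem} (s : SGradT B k t) :
    XgradT B k t →ₗ[ℝ] polyOn (M.elem t) ((k : ℤ) + 1) :=
  linSol fun q (P : polyOn (M.elem t) ((k : ℤ) + 1)) => ∀ w ∈ M.RolycT t ((k : ℤ) + 2),
    M.intT t (P * dvg w) = -M.intT t (elemGrad sF s q ⬝ᵥ w) +
      ∑ f, M.ωTF t f.1 *
        M.intF f.1 (facePot (sF f.1) (resGradTF B k t f q) * (w ⬝ᵥ cst (M.normal f.1)))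

/-! ### Operators on the curl space -/

variable (B k) in
/-- The face curl. -/
noncomputable def faceCurl (f : M.Face) : XcurlF B k f →ₗ[ℝ] polyOn (M.face f) (k : ℤ) :=
  linSol fun v (c : polyOn (M.face f) (k : ℤ)) => ∀ r ∈ polyOn (M.face f) (k : ℤ),
    M.intF f (c * r) = M.intF f (v.1.1 ⬝ᵥ vrot (M.normal f) r) -
      ∑ e, M.ωFE f e.1 * M.intE e.1 (v.2 e * r)

/-- The face tangential potential. -/
noncomputable def faceTan {f : M.Face} (s : SCurlF B k f) :
    XcurlF B k f →ₗ[ℝ] vPolyOn (M.face f) (k : ℤ) :=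
  linSol fun v (γ : vPolyOn (M.face f) (k : ℤ)) =>
    ∀ r ∈ polyOn (M.face f) ((k : ℤ) + 1), M.intF f r = 0 → ∀ τ ∈ M.RolycF f k,
      M.intF f (γ ⬝ᵥ (vrot (M.normal f) r + τ)) = M.intF f (faceCurl B k f v * r) +
        ∑ e, M.ωFE f e.1 * M.intE e.1 (v.2 e * r) + M.intF f (s v ⬝ᵥ τ)

/-- The element curl. -/
noncomputable def elemCurl (sF : ∀ f, SCurlF B k f) (t : M.Elem) :
    XcurlT B k t →ₗ[ℝ] vPolyOn (M.elem t) (k : ℤ) :=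
  linSol fun v (c : vPolyOn (M.elem t) (k : ℤ)) => ∀ w ∈ vPolyOn (M.elem t) (k : ℤ),
    M.intT t (c ⬝ᵥ w) = M.intT t (v.1.1 ⬝ᵥ curl w) +
      ∑ f, M.ωTF t f.1 *
        M.intF f.1 (faceTan (sF f.1) (resCurlTF B k t f v) ⬝ᵥ (w ⨯₃ cst (M.normal f.1)))

/-- The element vector potential `P_curl`. -/
noncomputable def elemVec (sF : ∀ f, SCurlF B k f) {t : M.Elem} (s : SCurlT B k t) :
    XcurlT B k t →ₗ[ℝ] vPolyOn (M.elem t) (k : ℤ) :=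
  linSol fun v (P : vPolyOn (M.elem t) (k : ℤ)) =>
    ∀ w ∈ M.GolycT t ((k : ℤ) + 1), ∀ τ ∈ M.RolycT t k,
      M.intT t (P ⬝ᵥ (curl w + τ)) = M.intT t (elemCurl sF t v ⬝ᵥ w) -
        ∑ f, M.ωTF t f.1 *
          M.intF f.1 (faceTan (sF f.1) (resCurlTF B k t f v) ⬝ᵥ (w ⨯₃ cst (M.normal f.1))) +
        M.intT t (s v ⬝ᵥ τ)

/-! ### Operators on the divergence space -/

variable (k) in
/-- The element divergence. -/
noncomputable def elemDiv (t : M.Elem) : XdivT k t →ₗ[ℝ] polyOn (M.elem t) (k : ℤ) :=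
  linSol fun w (d : polyOn (M.elem t) (k : ℤ)) => ∀ q ∈ polyOn (M.elem t) (k : ℤ),
    M.intT t (d * q) = -M.intT t (w.1.1 ⬝ᵥ grad q) +
      ∑ f, M.ωTF t f.1 * M.intF f.1 (w.2 f * q)

variable (k) in
/-- The element vector potential `P_div`. -/
noncomputable def elemDivPot (t : M.Elem) : XdivT k t →ₗ[ℝ] vPolyOn (M.elem t) (k : ℤ) :=
  linSol fun w (P : vPolyOn (M.elem t) (k : ℤ)) =>
    ∀ r ∈ polyOn (M.elem t) ((k : ℤ) + 1), M.intT t r = 0 → ∀ τ ∈ M.GolycT t k,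
      M.intT t (P ⬝ᵥ (grad r + τ)) = -M.intT t (elemDiv k t w * r) +
        ∑ f, M.ωTF t f.1 * M.intF f.1 (w.2 f * r) + M.intT t (w.1.2 ⬝ᵥ τ)

/-! ### The usual serendipity operators

They reconstruct a gradient (resp. a vector field) with prescribed projection on `ℛ^{c,ℓ_P+1}(P)`
whose curl and tangential traces fit those of the data in the least square sense; the constraint is
imposed by a Lagrange multiplier `ζ`. -/

variable (B k) in
/-- The usual serendipity gradient on a face. -/
noncomputable def usualGradF (f : M.Face) : SGradF B k f :=
  linSol fun q (σ : vPolyOn (M.face f) (k : ℤ)) => ∃ ζ ∈ M.RolycF f (degF B k f + 1),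
    (∀ τ ∈ vPolyOn (M.face f) (k : ℤ),
      Metric.diam (M.face f) ^ 2 *
          M.intF f (srot (M.normal f) σ * srot (M.normal f) τ) +
        Metric.diam (M.face f) * ∑ e : M.edgesF f,
          M.intE e.1 ((σ ⬝ᵥ cst (M.tangent e.1)) * (τ ⬝ᵥ cst (M.tangent e.1))) +
        M.intF f (ζ ⬝ᵥ τ) =
      Metric.diam (M.face f) * ∑ e : M.edgesF f,
        M.intE e.1 (edgeGrad e.1 (resGradFE B k f e q) * (τ ⬝ᵥ cst (M.tangent e.1)))) ∧
    ∀ μ ∈ M.RolycF f (degF B k f + 1),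
      M.intF f (σ ⬝ᵥ μ) = -M.intF f (q.1 * dvg μ) + ∑ e, M.ωFE f e.1 *
        M.intE e.1 (edgePot e.1 (resGradFE B k f e q) * (μ ⬝ᵥ cst (M.normalFE f e.1)))

variable (B k) in
/-- The usual serendipity curl operator on a face. -/
noncomputable def usualCurlF (f : M.Face) : SCurlF B k f :=
  linSol fun v (σ : vPolyOn (M.face f) (k : ℤ)) => ∃ ζ ∈ M.RolycF f (degF B k f + 1),
    (∀ τ ∈ vPolyOn (M.face f) (k : ℤ),
      Metric.diam (M.face f) ^ 2 *
          M.intF f (srot (M.normal f) σ * srot (M.normal f) τ) +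
        Metric.diam (M.face f) * ∑ e : M.edgesF f,
          M.intE e.1 ((σ ⬝ᵥ cst (M.tangent e.1)) * (τ ⬝ᵥ cst (M.tangent e.1))) +
        M.intF f (ζ ⬝ᵥ τ) =
      Metric.diam (M.face f) ^ 2 *
          M.intF f (faceCurl B k f v * srot (M.normal f) τ) +
        Metric.diam (M.face f) * ∑ e : M.edgesF f,
          M.intE e.1 (v.2 e * (τ ⬝ᵥ cst (M.tangent e.1)))) ∧
    ∀ μ ∈ M.RolycF f (degF B k f + 1), M.intF f (σ ⬝ᵥ μ) = M.intF f (v.1.2 ⬝ᵥ μ)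

variable (B k) in
/-- The usual serendipity gradient on an element. -/
noncomputable def usualGradT (t : M.Elem) : SGradT B k t :=
  linSol fun q (σ : vPolyOn (M.elem t) (k : ℤ)) => ∃ ζ ∈ M.RolycT t (degT B k t + 1),
    (∀ τ ∈ vPolyOn (M.elem t) (k : ℤ),
      Metric.diam (M.elem t) ^ 2 * M.intT t (curl σ ⬝ᵥ curl τ) +
        Metric.diam (M.elem t) * ∑ f : M.facesT t,
          M.intF f.1 (tang (M.normal f.1) σ ⬝ᵥ tang (M.normal f.1) τ) +
        M.intT t (ζ ⬝ᵥ τ) =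
      Metric.diam (M.elem t) * ∑ f : M.facesT t,
        M.intF f.1 (faceGrad (usualGradF B k f.1) (resGradTF B k t f q) ⬝ᵥ
          tang (M.normal f.1) τ)) ∧
    ∀ μ ∈ M.RolycT t (degT B k t + 1),
      M.intT t (σ ⬝ᵥ μ) = -M.intT t (q.1 * dvg μ) + ∑ f, M.ωTF t f.1 *
        M.intF f.1 (facePot (usualGradF B k f.1) (resGradTF B k t f q) *
          (μ ⬝ᵥ cst (M.normal f.1)))

variable (B k) in
/-- The usual serendipity curl operator on an element. -/
noncomputable def usualCurlT (t : M.Elem) : SCurlT B k t :=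
  linSol fun v (σ : vPolyOn (M.elem t) (k : ℤ)) => ∃ ζ ∈ M.RolycT t (degT B k t + 1),
    (∀ τ ∈ vPolyOn (M.elem t) (k : ℤ),
      Metric.diam (M.elem t) ^ 2 * M.intT t (curl σ ⬝ᵥ curl τ) +
        Metric.diam (M.elem t) * ∑ f : M.facesT t,
          M.intF f.1 (tang (M.normal f.1) σ ⬝ᵥ tang (M.normal f.1) τ) +
        M.intT t (ζ ⬝ᵥ τ) =
      Metric.diam (M.elem t) ^ 2 *
          M.intT t (elemCurl (usualCurlF B k) t v ⬝ᵥ curl τ) +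
        Metric.diam (M.elem t) * ∑ f : M.facesT t,
          M.intF f.1 (faceTan (usualCurlF B k f.1) (resCurlTF B k t f v) ⬝ᵥ
            tang (M.normal f.1) τ)) ∧
    ∀ μ ∈ M.RolycT t (degT B k t + 1), M.intT t (σ ⬝ᵥ μ) = M.intT t (v.1.2 ⬝ᵥ μ)

variable (B k) in
/-- The usual serendipity operators. -/
noncomputable def usualSerendipity : SerendipityOps B k where
  gradF := usualGradF B k
  curlF := usualCurlF B k
  gradT := usualGradT B k
  curlT := usualCurlT B k

/-! ### Discrete operators and inner products on the mesh -/

variable (S : SerendipityOps B k)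

/-- The discrete gradient. -/
noncomputable def discGrad : Xgrad B k →ₗ[ℝ] Xcurl B k :=
  (LinearMap.pi fun t =>
    ((projV (M.intT t) (M.RolyT t ((k : ℤ) - 1))).prod
      (projV (M.intT t) (M.RolycT t (degT B k t + 1)))) ∘ₗ
        (vPolyOn (M.elem t) (k : ℤ)).subtype ∘ₗ elemGrad S.gradF (S.gradT t) ∘ₗ
          resGradT B k t).prod
  ((LinearMap.pi fun f =>
    ((projV (M.intF f) (M.RolyF f ((k : ℤ) - 1))).prod
      (projV (M.intF f) (M.RolycF f (degF B k f + 1)))) ∘ₗ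
        (vPolyOn (M.face f) (k : ℤ)).subtype ∘ₗ faceGrad (S.gradF f) ∘ₗ
          resGradF B k f).prod
  (LinearMap.pi fun e => edgeGrad e ∘ₗ resGradE B k e))

/-- The discrete curl. -/
noncomputable def discCurl : Xcurl B k →ₗ[ℝ] Xdiv M k :=
  (LinearMap.pi fun t =>
    ((projV (M.intT t) (M.GolyT t ((k : ℤ) - 1))).prod
      (projV (M.intT t) (M.GolycT t (k : ℤ)))) ∘ₗ
        (vPolyOn (M.elem t) (k : ℤ)).subtype ∘ₗ elemCurl S.curlF t ∘ₗ
          resCurlT B k t).prod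
  (LinearMap.pi fun f => faceCurl B k f ∘ₗ resCurlF B k f)

/-- The piecewise polynomial scalar potential on the mesh. -/
noncomputable def potGrad : Xgrad B k →ₗ[ℝ] (M.Elem → Pol) :=
  LinearMap.pi fun t =>
    (polyOn (M.elem t) ((k : ℤ) + 1)).subtype ∘ₗ elemPot S.gradF (S.gradT t) ∘ₗ resGradT B k t

/-- The piecewise polynomial vector potential on the mesh. -/
noncomputable def potCurl : Xcurl B k →ₗ[ℝ] (M.Elem → VPol) :=
  LinearMap.pi fun t =>
    (vPolyOn (M.elem t) (k : ℤ)).subtype ∘ₗ elemVec S.curlF (S.curlT t) ∘ₗ resCurlT B k t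

/-- The piecewise polynomial curl on the mesh. -/
noncomputable def pwCurl : Xcurl B k →ₗ[ℝ] (M.Elem → VPol) :=
  LinearMap.pi fun t =>
    (vPolyOn (M.elem t) (k : ℤ)).subtype ∘ₗ elemCurl S.curlF t ∘ₗ resCurlT B k t

/-- The discrete `L²`-product on the curl space of an element (with its stabilisation). -/
noncomputable def innerCurlT (t : M.Elem) : LinearMap.BilinForm ℝ (XcurlT B k t) :=
  let P : XcurlT B k t →ₗ[ℝ] VPol :=
    (vPolyOn (M.elem t) (k : ℤ)).subtype ∘ₗ elemVec S.curlF (S.curlT t)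
  let dF (f : M.facesT t) : XcurlT B k t →ₗ[ℝ] VPol := tang (M.normal f.1) ∘ₗ P -
    (vPolyOn (M.face f.1) (k : ℤ)).subtype ∘ₗ faceTan (S.curlF f.1) ∘ₗ resCurlTF B k t f
  let dE (e : M.edgesT t) : XcurlT B k t →ₗ[ℝ] Pol := dot (cst (M.tangent e.1)) ∘ₗ P -
    (polyOn (M.seg e.1) (k : ℤ)).subtype ∘ₗ LinearMap.proj e ∘ₗ LinearMap.snd ℝ _ _ ∘ₗ
      LinearMap.snd ℝ _ _
  (l2V (M.intT t)).comp P P +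
    (∑ f : M.facesT t, Metric.diam (M.face f.1) • (l2V (M.intF f.1)).comp (dF f) (dF f) +
      ∑ e : M.edgesT t, Metric.diam (M.seg e.1) ^ 2 • (l2S (M.intE e.1)).comp (dE e) (dE e))

/-- The discrete `L²`-product on the divergence space of an element (with its stabilisation). -/
noncomputable def innerDivT (t : M.Elem) : LinearMap.BilinForm ℝ (XdivT k t) :=
  let P : XdivT k t →ₗ[ℝ] VPol := (vPolyOn (M.elem t) (k : ℤ)).subtype ∘ₗ elemDivPot k t
  let dF (f : M.facesT t) : XdivT k t →ₗ[ℝ] Pol := dot (cst (M.normal f.1)) ∘ₗ P -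
    (polyOn (M.face f.1) (k : ℤ)).subtype ∘ₗ LinearMap.proj f ∘ₗ LinearMap.snd ℝ _ _
  (l2V (M.intT t)).comp P P +
    ∑ f : M.facesT t, Metric.diam (M.face f.1) • (l2S (M.intF f.1)).comp (dF f) (dF f)

/-- The discrete `L²`-product on the curl space. -/
noncomputable def innerCurl : LinearMap.BilinForm ℝ (Xcurl B k) :=
  ∑ t, (innerCurlT S t).comp (resCurlT B k t) (resCurlT B k t)

variable (M k) in
/-- The discrete `L²`-product on the divergence space. -/
noncomputable def innerDiv : LinearMap.BilinForm ℝ (Xdiv M k) :=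
  ∑ t, (innerDivT t).comp (resDivT k t) (resDivT k t)

variable (M) in
/-- The `L²`-product of piecewise polynomial vector fields over the domain, which is the union of
the elements, up to overlaps of measure zero. -/
noncomputable def innerL2 : LinearMap.BilinForm ℝ (M.Elem → VPol) :=
  ∑ t, (l2V (M.intT t)).comp (LinearMap.proj t) (LinearMap.proj t)

variable (M) in
/-- Product of a piecewise polynomial vector field and a scalar one. -/
noncomputable def pwScal : (M.Elem → VPol) →ₗ[ℝ] (M.Elem → Pol) →ₗ[ℝ] (M.Elem → VPol) :=
  LinearMap.mk₂ ℝ (fun v p t => scal (v t) (p t)) (by intros; ext1; simp)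
    (by intros; ext1; simp) (by intros; ext1; simp) (by intros; ext1; simp)

variable (M) in
/-- Cross product of piecewise polynomial vector fields. -/
noncomputable def pwCross : (M.Elem → VPol) →ₗ[ℝ] (M.Elem → VPol) →ₗ[ℝ] (M.Elem → VPol) :=
  LinearMap.mk₂ ℝ (fun v w t => cross (v t) (w t)) (by intros; ext1; simp)
    (by intros; ext1; simp) (by intros; ext1; simp) (by intros; ext1; simp)

/-- The discrete cross product `X_curl × X_curl → X_div`, obtained by projecting on the components
of `X_div` the cross products of the element vector potentials and the normal components of the
cross products of the face tangential potentials. -/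
noncomputable def discCross : Xcurl B k →ₗ[ℝ] Xcurl B k →ₗ[ℝ] Xdiv M k :=
  let P (t : M.Elem) : Xcurl B k →ₗ[ℝ] VPol := LinearMap.proj t ∘ₗ potCurl S
  let γ (f : M.Face) : Xcurl B k →ₗ[ℝ] VPol :=
    (vPolyOn (M.face f) (k : ℤ)).subtype ∘ₗ faceTan (S.curlF f) ∘ₗ resCurlF B k f
  LinearMap.mk₂ ℝ (fun v w =>
    (fun t => (projV (M.intT t) (M.GolyT t ((k : ℤ) - 1)) (cross (P t v) (P t w)),
      projV (M.intT t) (M.GolycT t (k : ℤ)) (cross (P t v) (P t w))),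
    fun f => projS (M.intF f) (polyOn (M.face f) (k : ℤ))
      (dot (cst (M.normal f)) (cross (γ f v) (γ f w)))))
    (by intros; ext1 <;> ext1 <;> simp)
    (by intros; ext1 <;> ext1 <;> simp)
    (by intros; ext1 <;> ext1 <;> simp)
    (by intros; ext1 <;> ext1 <;> simp)

end SDDR

/-! ## Lie algebra-valued objects and the schemes -/

section Lie

variable {M : PolyMesh} {B : BoundarySelection M} {k : ℕ} (S : SerendipityOps B k)
variable {𝔤 : Type*} [LieRing 𝔤] [LieAlgebra ℝ 𝔤] (ip : LinearMap.BilinForm ℝ 𝔤)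

variable (𝔤) in
/-- The bracket of a Lie algebra as a bilinear map. -/
def lieMap : 𝔤 →ₗ[ℝ] 𝔤 →ₗ[ℝ] 𝔤 :=
  LinearMap.mk₂ ℝ (fun a b => ⁅a, b⁆) add_lie smul_lie lie_add lie_smul

variable (M 𝔤) in
/-- The bracket `[v ⊗ a, q ⊗ b] = v q ⊗ [a, b]` of a vector field and a scalar field. -/
noncomputable def bktVS : (M.Elem → VPol) ⊗[ℝ] 𝔤 →ₗ[ℝ] (M.Elem → Pol) ⊗[ℝ] 𝔤 →ₗ[ℝ]
    (M.Elem → VPol) ⊗[ℝ] 𝔤 :=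
  TensorProduct.map₂ (pwScal M) (lieMap 𝔤)

variable (M 𝔤) in
/-- The bracket `⋆[v ⊗ a, w ⊗ b] = (v × w) ⊗ [a, b]` of two vector fields. -/
noncomputable def bktVV : (M.Elem → VPol) ⊗[ℝ] 𝔤 →ₗ[ℝ] (M.Elem → VPol) ⊗[ℝ] 𝔤 →ₗ[ℝ]
    (M.Elem → VPol) ⊗[ℝ] 𝔤 :=
  TensorProduct.map₂ (pwCross M) (lieMap 𝔤)

variable (𝔤) in
/-- The discrete version of the bracket of two vector fields, with values in the Lie algebra-valued
divergence space. -/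
noncomputable def bktDisc : Xcurl B k ⊗[ℝ] 𝔤 →ₗ[ℝ] Xcurl B k ⊗[ℝ] 𝔤 →ₗ[ℝ] Xdiv M k ⊗[ℝ] 𝔤 :=
  TensorProduct.map₂ (discCross S) (lieMap 𝔤)

/-- The inner product of the Lie algebra-valued curl space. -/
noncomputable def innerCurlG : LinearMap.BilinForm ℝ (Xcurl B k ⊗[ℝ] 𝔤) :=
  LinearMap.BilinForm.tmul (innerCurl S) ip

variable (M k) in
/-- The inner product of the Lie algebra-valued divergence space. -/
noncomputable def innerDivG : LinearMap.BilinForm ℝ (Xdiv M k ⊗[ℝ] 𝔤) :=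
  LinearMap.BilinForm.tmul (innerDiv M k) ip

variable (M) in
/-- The integral `∫ ⟨v, w⟩` of Lie algebra-valued piecewise polynomial vector fields. -/
noncomputable def innerL2G : LinearMap.BilinForm ℝ ((M.Elem → VPol) ⊗[ℝ] 𝔤) :=
  LinearMap.BilinForm.tmul (innerL2 M) ip

variable (𝔤) in
/-- The Lie algebra-valued discrete gradient. -/
noncomputable def discGradG : Xgrad B k ⊗[ℝ] 𝔤 →ₗ[ℝ] Xcurl B k ⊗[ℝ] 𝔤 :=
  (discGrad S).rTensor 𝔤

variable (𝔤) in
/-- The Lie algebra-valued discrete curl. -/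
noncomputable def discCurlG : Xcurl B k ⊗[ℝ] 𝔤 →ₗ[ℝ] Xdiv M k ⊗[ℝ] 𝔤 :=
  (discCurl S).rTensor 𝔤

variable (𝔤) in
/-- The Lie algebra-valued piecewise polynomial scalar potential. -/
noncomputable def potGradG : Xgrad B k ⊗[ℝ] 𝔤 →ₗ[ℝ] (M.Elem → Pol) ⊗[ℝ] 𝔤 :=
  (potGrad S).rTensor 𝔤

variable (𝔤) in
/-- The Lie algebra-valued piecewise polynomial vector potential. -/
noncomputable def potCurlG : Xcurl B k ⊗[ℝ] 𝔤 →ₗ[ℝ] (M.Elem → VPol) ⊗[ℝ] 𝔤 :=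
  (potCurl S).rTensor 𝔤

variable (𝔤) in
/-- The Lie algebra-valued piecewise polynomial curl. -/
noncomputable def pwCurlG : Xcurl B k ⊗[ℝ] 𝔤 →ₗ[ℝ] (M.Elem → VPol) ⊗[ℝ] 𝔤 :=
  (pwCurl S).rTensor 𝔤

/-- The two discretisations of the nonlinear terms. -/
inductive NonlinearChoice
  | N1
  | N2

/-- The nonlinear term `𝔑(A, A'; v)`, for `A` and `A'` the potentials at two successive times. -/
noncomputable def nonlin : NonlinearChoice →
    Xcurl B k ⊗[ℝ] 𝔤 → Xcurl B k ⊗[ℝ] 𝔤 → Xcurl B k ⊗[ℝ] 𝔤 → ℝ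
  | .N1, A, A', v =>
    let Am := (1 / 2 : ℝ) • (A + A')
    innerDivG M k ip (discCurlG S 𝔤 A') (bktDisc S 𝔤 Am v) +
      innerDivG M k ip ((1 / 2 : ℝ) • bktDisc S 𝔤 A' A') (discCurlG S 𝔤 v + bktDisc S 𝔤 Am v)
  | .N2, A, A', v =>
    let Am := (1 / 2 : ℝ) • (A + A')
    let P := potCurlG S 𝔤
    innerL2G M ip (pwCurlG S 𝔤 A') (bktVV M 𝔤 (P Am) (P v)) +
      innerL2G M ip ((1 / 2 : ℝ) • bktVV M 𝔤 (P A') (P A'))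
        (pwCurlG S 𝔤 v + bktVV M 𝔤 (P Am) (P v))

/-- The discrete time derivative `δ_t^{n+1} v`. -/
noncomputable def dt {X : Type*} [AddCommGroup X] [Module ℝ X] {N : ℕ} (τ : Fin (N + 1) → ℝ)
    (v : Fin (N + 1) → X) (n : Fin N) : X :=
  (τ n.succ - τ n.castSucc)⁻¹ • (v n.succ - v n.castSucc)

/-- The families `A`, `E`, `lam` solve the constrained scheme on the time grid `τ`. -/
structure IsSolution (c : NonlinearChoice) {N : ℕ} (τ : Fin (N + 1) → ℝ)
    (A E : Fin (N + 1) → Xcurl B k ⊗[ℝ] 𝔤) (lam : Fin (N + 1) → Xgrad B k ⊗[ℝ] 𝔤) : Prop where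
  potential_eq : ∀ n : Fin N, dt τ A n = -E n.succ
  field_eq : ∀ n : Fin N, ∀ v : Xcurl B k ⊗[ℝ] 𝔤,
    innerCurlG S ip (dt τ E n) v + innerCurlG S ip (discGradG S 𝔤 (lam n.succ)) v +
      innerL2G M ip (bktVS M 𝔤 (potCurlG S 𝔤 (A n.succ)) (potGradG S 𝔤 (lam n.succ)))
        (potCurlG S 𝔤 v) =
    innerDivG M k ip (discCurlG S 𝔤 (A n.succ)) (discCurlG S 𝔤 v) +
      nonlin S ip c (A n.castSucc) (A n.succ) v
  constraint_eq : ∀ n : Fin N, ∀ q : Xgrad B k ⊗[ℝ] 𝔤,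
    innerCurlG S ip (dt τ E n) (discGradG S 𝔤 q) +
      innerL2G M ip (potCurlG S 𝔤 (dt τ E n))
        (bktVS M 𝔤 (potCurlG S 𝔤 (A n.castSucc)) (potGradG S 𝔤 q)) = 0

/-- The constraint functional of a potential `A` and an electric field `E`. -/
noncomputable def constraint (A E : Xcurl B k ⊗[ℝ] 𝔤) (q : Xgrad B k ⊗[ℝ] 𝔤) : ℝ :=
  innerCurlG S ip E (discGradG S 𝔤 q) +
    innerL2G M ip (potCurlG S 𝔤 E) (bktVS M 𝔤 (potCurlG S 𝔤 A) (potGradG S 𝔤 q))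

end Lie

end YMDDR

namespace YMDDR

open TensorProduct

/-! Write `𝔠(A, E; q)` for the constraint functional. It is linear in `E` and affine in `A`, the
potential entering only through the term `∫ ⟨P E, [P A, P q]⟩`, where `P` stands for the vector or
scalar potential reconstruction. Conservation over one time step of length `s` splits into a change
of potential and a change of field: `𝔠(Aⁿ⁺¹, Eⁿ⁺¹) - 𝔠(Aⁿ, Eⁿ) = [𝔠(Aⁿ⁺¹, Eⁿ⁺¹) - 𝔠(Aⁿ, Eⁿ⁺¹)] +
[𝔠(Aⁿ, Eⁿ⁺¹) - 𝔠(Aⁿ, Eⁿ)]`.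

In the first bracket `Aⁿ⁺¹ - Aⁿ = -s Eⁿ⁺¹`, so what is left is `-s ∫ ⟨P Eⁿ⁺¹, [P Eⁿ⁺¹, P q]⟩`. This
vanishes because ad-invariance makes `(v, w) ↦ ∫ ⟨v, [w, p]⟩` antisymmetric
(`innerL2G_bktVS_antisymm`, `innerL2G_bktVS_self`). The second bracket is `s 𝔠(Aⁿ, δE)` by linearity
in the field, and `𝔠(Aⁿ, δE) = 0` is exactly the constraint equation of the scheme.
`IsSolution.constraint_succ` assembles the two brackets; an induction on the time index concludes.

The time levels have to match: the potential is updated with the new field, so that the same field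
fills both slots of the antisymmetric form, while the constraint equation is tested with the old
potential. The discrete operators intervene only through their linearity: the cancellation takes
place after the vector potentials have been formed, whatever polynomial fields they produce. -/

theorem succ_eq_add_smul_dt {X : Type*} [AddCommGroup X] [Module ℝ X] {N : ℕ}
    {τ : Fin (N + 1) → ℝ} (hτ : StrictMono τ) (v : Fin (N + 1) → X) (n : Fin N) :
    v n.succ = v n.castSucc + (τ n.succ - τ n.castSucc) • dt τ v n := by
  -- Strict monotonicity makes the time step nonzero. On a degenerate step the inverse in `dt` would
  -- be `0` by convention and the identity could fail.
  rw [dt, smul_inv_smul₀ (sub_pos.2 (hτ n.castSucc_lt_succ)).ne', add_sub_cancel]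

section Lie

variable {M : PolyMesh} {B : BoundarySelection M} {k : ℕ} (S : SerendipityOps B k)
variable {𝔤 : Type*} [LieRing 𝔤] [LieAlgebra ℝ 𝔤] {ip : LinearMap.BilinForm ℝ 𝔤}

/-! ### Antisymmetry of the bracket for the `L²`-product -/

/-- Both sides are `∑ₜ ∫ (v ⬝ᵥ w) p`. This is the symmetric, real-valued half of the antisymmetry
below; the sign comes entirely from the Lie algebra factor. -/
theorem innerL2_pwScal_comm (v w : M.Elem → VPol) (p : M.Elem → Pol) :
    innerL2 M v (pwScal M w p) = innerL2 M w (pwScal M v p) := by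
  simp [innerL2, pwScal, scal, l2V, dot, dotProduct_comm]

/-- The form `(v, w) ↦ ∫ ⟨v, [w, p]⟩` is antisymmetric, since the inner product of the Lie algebra
is ad-invariant. -/
theorem innerL2G_bktVS_antisymm (ip_symm : ip.IsSymm) (ip_invariant : ip.lieInvariant 𝔤)
    (v w : (M.Elem → VPol) ⊗[ℝ] 𝔤) (p : (M.Elem → Pol) ⊗[ℝ] 𝔤) :
    innerL2G M ip v (bktVS M 𝔤 w p) = -innerL2G M ip w (bktVS M 𝔤 v p) := by
  -- Both sides are additive in each of `p`, `v`, `w`, so it suffices to treat pure tensors, where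
  -- the form factors as `(∫ (v ⬝ᵥ w) r) * ip a ⁅b, c⁆`.
  induction p with
  | zero => simp
  | add p p' hp hp' => simp only [map_add, hp, hp', neg_add]
  | tmul r c =>
    induction v with
    | zero => simp
    | add v v' hv hv' => simp only [map_add, LinearMap.add_apply, hv, hv', neg_add]
    | tmul v a =>
      induction w with
      | zero => simp
      | add w w' hw hw' => simp only [map_add, LinearMap.add_apply, hw, hw', neg_add]
      | tmul w b =>
        -- Invariance says that `ad c` is skew-adjoint for `ip`. It is stated with `c` on the left
        -- of the bracket, so both brackets are flipped first; the symmetry of `ip` then exchanges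
        -- the two slots.
        have hab : ip a ⁅b, c⁆ = -ip b ⁅a, c⁆ := by
          have h := ip_invariant c a b
          rw [← lie_skew b c, ← lie_skew a c, map_neg, map_neg, ← h, neg_neg]
          exact ip_symm.eq _ _
        simp only [innerL2G, bktVS, lieMap, map₂_apply_tmul, LinearMap.BilinForm.tmul]
        -- The scalar factors on the two sides are identified by symmetry, and the Lie algebra
        -- factors are opposite by `hab`.
        simp [innerL2_pwScal_comm w v r, hab]

/-- An antisymmetric real form vanishes on the diagonal. Applied to the reconstructed electric
field, this removes the only term that the update of the potential adds to the constraint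
functional. -/
theorem innerL2G_bktVS_self (ip_symm : ip.IsSymm) (ip_invariant : ip.lieInvariant 𝔤)
    (v : (M.Elem → VPol) ⊗[ℝ] 𝔤) (p : (M.Elem → Pol) ⊗[ℝ] 𝔤) :
    innerL2G M ip v (bktVS M 𝔤 v p) = 0 := by
  linarith [innerL2G_bktVS_antisymm ip_symm ip_invariant v v p]

/-! ### Conservation over one time step -/

variable {S}

/-- The passage goes through the mixed state `(Aⁿ, Eⁿ⁺¹)`: antisymmetry allows the potential to be
moved back in time at fixed new field, and the constraint equation then allows the field to be moved
back at fixed old potential. -/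
theorem IsSolution.constraint_succ (ip_symm : ip.IsSymm) (ip_invariant : ip.lieInvariant 𝔤)
    {c : NonlinearChoice} {N : ℕ} {τ : Fin (N + 1) → ℝ} (hτ : StrictMono τ)
    {A E : Fin (N + 1) → Xcurl B k ⊗[ℝ] 𝔤} {lam : Fin (N + 1) → Xgrad B k ⊗[ℝ] 𝔤}
    (h : IsSolution S ip c τ A E lam) (q : Xgrad B k ⊗[ℝ] 𝔤) (n : Fin N) :
    constraint S ip (A n.succ) (E n.succ) q = constraint S ip (A n.castSucc) (E n.castSucc) q := by
  have hE := succ_eq_add_smul_dt hτ E n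
  have hA := succ_eq_add_smul_dt hτ A n
  -- This turns the update into `Aⁿ⁺¹ = Aⁿ + s • (-Eⁿ⁺¹)`, with the new field and not the old one;
  -- `h1` applies because of this.
  rw [h.potential_eq n] at hA
  have hneg : potCurlG S 𝔤 (-E n.succ) = -potCurlG S 𝔤 (E n.succ) :=
    map_neg (potCurlG S 𝔤) (E n.succ)
  have h0 := h.constraint_eq n q
  have h1 := innerL2G_bktVS_self ip_symm ip_invariant (potCurlG S 𝔤 (E n.succ)) (potGradG S 𝔤 q)
  have h2 : constraint S ip (A n.succ) (E n.succ) q =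
      constraint S ip (A n.castSucc) (E n.succ) q := by
    simp only [constraint]
    conv_lhs => rw [hA]
    -- Expanding in the potential leaves, besides the terms of the right-hand side, a multiple of
    -- the diagonal value of the antisymmetric form at `potCurlG S 𝔤 (E n.succ)`, which `h1` sets to
    -- zero.
    simp only [map_add, map_smul, hneg, map_neg, LinearMap.add_apply, LinearMap.smul_apply,
      LinearMap.neg_apply, smul_eq_mul, h1]
    ring
  -- Once `h2` has replaced the potential by the old one, the two sides differ only in the field, in
  -- which the functional is linear.
  rw [h2, hE]
  simp only [constraint, map_add, map_smul, LinearMap.add_apply, LinearMap.smul_apply, smul_eq_mul]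
  -- The left-hand side of `h0` is the constraint functional at `A n.castSucc` and `dt τ E n`, so
  -- the difference of the two sides is the time step times `h0`.
  linear_combination (τ n.succ - τ n.castSucc) * h0

end Lie

end YMDDR

open YMDDR TensorProduct in
theorem proposition1 {M : PolyMesh} {B : BoundarySelection M} {k : ℕ} (S : SerendipityOps B k)
    {𝔤 : Type*} [LieRing 𝔤] [LieAlgebra ℝ 𝔤] [FiniteDimensional ℝ 𝔤]
    (ip : LinearMap.BilinForm ℝ 𝔤) (ip_symm : ip.IsSymm) (ip_pos : ∀ x, x ≠ 0 → 0 < ip x x)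
    (ip_invariant : ip.lieInvariant 𝔤)
    (c : NonlinearChoice) {N : ℕ} (τ : Fin (N + 1) → ℝ) (hτ₀ : τ 0 = 0) (hτ : StrictMono τ)
    (A E : Fin (N + 1) → Xcurl B k ⊗[ℝ] 𝔤) (lam : Fin (N + 1) → Xgrad B k ⊗[ℝ] 𝔤)
    (h : IsSolution S ip c τ A E lam) (q : Xgrad B k ⊗[ℝ] 𝔤) (m n : Fin (N + 1)) :
    constraint S ip (A m) (E m) q = constraint S ip (A n) (E n) q := by
  -- Every time level is compared with the initial one, so that `m` and `n` need not be ordered.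
  have key : ∀ j, constraint S ip (A j) (E j) q = constraint S ip (A 0) (E 0) q := by
    intro j
    induction j using Fin.induction with
    | zero => rfl
    | succ i hi => rw [h.constraint_succ ip_symm ip_invariant hτ q i, hi]
  rw [key m, key n]
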